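/- Let $\mathbb{G}$ be a homogeneous group, that is, a Lie group on $\mathbb{R}^N$ (with its standard smooth structure) for which there are weights $\nu_1,\dots,\nu_N>0$ such that for every $t>0$ the dilation $D_t(x)=(t^{\nu_1}x_1,\dots,t^{\nu_N}x_N)$ is an automorphism of $\mathbb{G}$. Let $Q=\nu_1+\dots+\nu_N$ be its homogeneous dimension, let $dx$ be Lebesgue measure (which is the Haar measure of $\mathbb{G}$), and let $|\cdot|$ be a homogeneous quasi-norm on $\mathbb{G}$, that is, a continuous function $\mathbb{G}\to[0,\infty)$ with $|x^{-1}|=|x|$, $|D_t(x)|=t|x|$ for $t>0$, and $|x|=0$ if and only if $x=0$. Put $B(x,r)=\{y\in\mathbb{G}:|x^{-1}y|<r\}$. For $1<p<\infty$ and $0<\lambda<Q$, the global Morrey space $M^{\lambda}_{p}(\mathbb{G})$ consists of the real functions $f\in L^p_{\mathrm{loc}}(\mathbb{G})$ with $$\|f\|_{M^{\lambda}_{p}(\mathbb{G})}:=\Big(\sup_{x\in\mathbb{G}}\sup_{r>0}r^{-\lambda}\int_{B(x,r)}|f(y)|^p\,dy\Big)^{1/p}<\infty .$$ **Theorem (Adams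 type Hardy–Littlewood–Sobolev inequality).** Let $0<\gamma<Q$, $1<p<\frac{Q}{\gamma}$, $0<\lambda<Q-\gamma p$ and $\frac1q=\frac1p-\frac{\gamma}{Q-\lambda}$ (so that $p<q<\infty$). Then there is a constant $C>0$ such that for every $u\in M^{\lambda}_{p}(\mathbb{G})$ the integral $$I_\gamma u(x)=\int_{\mathbb{G}}|y^{-1}x|^{\gamma-Q}u(y)\,dy$$ converges absolutely for almost every $x\in\mathbb{G}$, $I_\gamma u$ belongs to $M^{\lambda}_{q}(\mathbb{G})$, and $$\|I_\gamma u\|_{M^{\lambda}_{q}(\mathbb{G})}\le C\,\|u\|_{M^{\lambda}_{p}(\mathbb{G})}.$$ -/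

import Mathlib

open MeasureTheory
open scoped ENNReal ContDiff Manifold

noncomputable section

/-- The anisotropic dilation `D_t (x₁, …, x_N) = (t ^ ν₁ * x₁, …, t ^ ν_N * x_N)` of `ℝ^N`. -/
def dilation {N : ℕ} (ν : Fin N → ℝ) (t : ℝ) (x : EuclideanSpace ℝ (Fin N)) :
    EuclideanSpace ℝ (Fin N) :=
  WithLp.toLp 2 fun i => t ^ ν i * x i

/-- A group structure on `ℝ^N` is a homogeneous group with dilation weights `ν₁, …, ν_N > 0` if it
is a (smooth) Lie group for the standard smooth structure of `ℝ^N` and all the dilations `D_t`,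
`t > 0`, are group automorphisms (they are bijective as `t > 0`). -/
structure IsHomogeneousGroup {N : ℕ} [Group (EuclideanSpace ℝ (Fin N))] (ν : Fin N → ℝ) :
    Prop where
  lieGroup : LieGroup (𝓡 N) ∞ (EuclideanSpace ℝ (Fin N))
  weight_pos : ∀ i, 0 < ν i
  dilation_mul : ∀ t : ℝ, 0 < t → ∀ x y : EuclideanSpace ℝ (Fin N),
    dilation ν t (x * y) = dilation ν t x * dilation ν t y

/-- The homogeneous dimension `Q = ν₁ + ⋯ + ν_N`. -/
def homogeneousDim {N : ℕ} (ν : Fin N → ℝ) : ℝ := ∑ i, ν i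

/-- Homogeneous quasi-norms: continuous, non-negative, symmetric, homogeneous of degree one with
respect to the dilations, and vanishing exactly at the origin of `ℝ^N` (which is the identity
element of a homogeneous group). No triangle inequality is required. -/
structure IsHomogeneousQuasiNorm {N : ℕ} [Group (EuclideanSpace ℝ (Fin N))] (ν : Fin N → ℝ)
    (nrm : EuclideanSpace ℝ (Fin N) → ℝ) : Prop where
  continuous : Continuous nrm
  nonneg : ∀ x, 0 ≤ nrm x
  inv : ∀ x, nrm x⁻¹ = nrm x
  dilation : ∀ t : ℝ, 0 < t → ∀ x, nrm (dilation ν t x) = t * nrm x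
  eq_zero_iff : ∀ x, nrm x = 0 ↔ x = 0

/-- The quasi-ball `B(x, r) = {y : |x⁻¹ y| < r}`. -/
def quasiBall {N : ℕ} [Group (EuclideanSpace ℝ (Fin N))] (nrm : EuclideanSpace ℝ (Fin N) → ℝ)
    (x : EuclideanSpace ℝ (Fin N)) (r : ℝ) : Set (EuclideanSpace ℝ (Fin N)) :=
  {y | nrm (x⁻¹ * y) < r}

/-- The global Morrey norm, as an extended non-negative number:
`(sup_x sup_{r > 0} r ^ (-lam) * ∫_{B(x, r)} |f| ^ p) ^ (1 / p)`. -/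
def morreyNorm {N : ℕ} [Group (EuclideanSpace ℝ (Fin N))] (nrm : EuclideanSpace ℝ (Fin N) → ℝ)
    (p lam : ℝ) (f : EuclideanSpace ℝ (Fin N) → ℝ) : ℝ≥0∞ :=
  (⨆ (x : EuclideanSpace ℝ (Fin N)) (r : ℝ) (_ : 0 < r),
    ENNReal.ofReal (r ^ (-lam)) * ∫⁻ y in quasiBall nrm x r, ‖f y‖ₑ ^ p) ^ (1 / p)

/-- Membership in the global Morrey space: `f` is measurable, locally in `L^p`, and has finite
Morrey norm. -/
structure MemMorrey {N : ℕ} [Group (EuclideanSpace ℝ (Fin N))]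
    (nrm : EuclideanSpace ℝ (Fin N) → ℝ) (p lam : ℝ) (f : EuclideanSpace ℝ (Fin N) → ℝ) :
    Prop where
  aestronglyMeasurable : AEStronglyMeasurable f volume
  memLp_of_isCompact : ∀ K : Set (EuclideanSpace ℝ (Fin N)), IsCompact K →
    MemLp f (ENNReal.ofReal p) (volume.restrict K)
  morreyNorm_lt_top : morreyNorm nrm p lam f < ⊤

/-- The integrand `y ↦ |y⁻¹ x| ^ (γ - Q) * u y` of the Riesz potential at `x`. -/
def rieszIntegrand {N : ℕ} [Group (EuclideanSpace ℝ (Fin N))] (ν : Fin N → ℝ)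
    (nrm : EuclideanSpace ℝ (Fin N) → ℝ) (γ : ℝ) (u : EuclideanSpace ℝ (Fin N) → ℝ)
    (x y : EuclideanSpace ℝ (Fin N)) : ℝ :=
  nrm (y⁻¹ * x) ^ (γ - homogeneousDim ν) * u y

/-- The Riesz potential `I_γ u (x) = ∫ |y⁻¹ x| ^ (γ - Q) * u y dy`, with respect to Lebesgue
measure, which is the Haar measure of a homogeneous group. -/
def rieszPotential {N : ℕ} [Group (EuclideanSpace ℝ (Fin N))] (ν : Fin N → ℝ)
    (nrm : EuclideanSpace ℝ (Fin N) → ℝ) (γ : ℝ) (u : EuclideanSpace ℝ (Fin N) → ℝ)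
    (x : EuclideanSpace ℝ (Fin N)) : ℝ :=
  ∫ y, rieszIntegrand ν nrm γ u x y

end

/-! The argument is Hedberg's, run in Morrey spaces. Cut the kernel into dyadic shells: the
potential of `|u|` at `x` is at most a constant times the sum over `k` of `2 ^ (k * γ)` times the
`Q`-dimensional average of `|u|` over the ball of radius `2 ^ k`. Each average is at most the
maximal function `M u x`; by Hölder and the Morrey condition it is also at most a multiple of `a * 2
^ (-k * β)`, with `β = (Q - lam) / p` and `a` a bound for the Morrey norm. Since `0 < γ < β`, the
first bound sums over small scales and the second over large ones. Balancing them gives `I |u| ≤ C *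
a ^ (γ / β) * (M u) ^ (1 - γ / β)`, where `1 - γ / β = p / q`, hence `(I |u|) ^ q ≤ C * a ^ (q - p)
* (M u) ^ p`.

It remains to bound the integral of `(M u) ^ p` over a ball of radius `r` by a multiple of `a ^ p *
r ^ lam`. Radii at most `r` see only the part of `u` in a dilated ball, to which the `L^p` maximal
theorem applies (Vitali covering, then the layer-cake formula); larger radii are handled by the
Hölder bound again.

All this uses only a continuous quasi-metric whose balls have measure at most `c * r ^ Q`. On a
homogeneous group, `|x⁻¹ y|` is one: compactness and scaling give the quasi-triangle inequality, and
Lebesgue measure is left invariant because translations commute with dilations up to moving the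
translating point. -/

/-- A continuous quasi-metric `d`, with quasi-triangle constant `A`, whose balls satisfy the upper
volume bound `μ (B (x, r)) ≤ c * r ^ Q`. -/
structure IsUpperRegularQuasiMetric {X : Type*} [TopologicalSpace X] [MeasurableSpace X]
    (μ : Measure X) (d : X → X → ℝ) (A c Q : ℝ) : Prop where
  continuous : Continuous fun z : X × X => d z.1 z.2
  nonneg : ∀ x y, 0 ≤ d x y
  self : ∀ x, d x x = 0
  symm : ∀ x y, d x y = d y x
  triangle : ∀ x y z, d x z ≤ A * (d x y + d y z)
  A_pos : 0 < A
  c_pos : 0 < c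
  Q_pos : 0 < Q
  measure_ball_le : ∀ x r, 0 < r → μ {y | d x y < r} ≤ ENNReal.ofReal (c * r ^ Q)

/-- The `Q`-dimensional average of `f` over the ball of centre `x` and radius `r`. -/
noncomputable def ballAverage {X : Type*} [MeasurableSpace X] (μ : Measure X) (d : X → X → ℝ)
    (Q : ℝ) (f : X → ℝ≥0∞) (x : X) (r : ℝ) : ℝ≥0∞ :=
  ENNReal.ofReal (r ^ (-Q)) * ∫⁻ y in {y | d x y < r}, f y ∂μ

/-- The Hardy–Littlewood maximal function over balls of dyadic radii. -/
noncomputable def dyadicMaximal {X : Type*} [MeasurableSpace X] (μ : Measure X) (d : X → X → ℝ)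
    (Q : ℝ) (f : X → ℝ≥0∞) (x : X) : ℝ≥0∞ :=
  ⨆ k : ℤ, ballAverage μ d Q f x (2 ^ k)

/-- The layer-cake integral, with `g = ⊤` allowed because the maximal function may be infinite. It
is used with exponent `p` for the maximal function and with `p - 1` for the truncation of `f`. -/
lemma lintegral_Ioi_indicator_rpow (g : ℝ≥0∞) {s : ℝ} (hs : 0 < s) :
    ∫⁻ t in Set.Ioi (0 : ℝ), {t | ENNReal.ofReal t < g}.indicator
      (fun t => ENNReal.ofReal (t ^ (s - 1))) t = g ^ s * ENNReal.ofReal s⁻¹ := by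
  have key : ∀ b : ℝ, 0 ≤ b → ∫⁻ t in Set.Ioo (0 : ℝ) b, ENNReal.ofReal (t ^ (s - 1))
      = ENNReal.ofReal b ^ s * ENNReal.ofReal s⁻¹ := by
    intro b hb
    have hI : IntervalIntegrable (fun x : ℝ => x ^ (s - 1)) volume 0 b :=
      intervalIntegral.intervalIntegrable_rpow' (by linarith)
    rw [intervalIntegrable_iff_integrableOn_Ioc_of_le hb] at hI
    rw [setLIntegral_congr Ioo_ae_eq_Ioc, ← ofReal_integral_eq_lintegral_ofReal hI]
    · rw [← intervalIntegral.integral_of_le hb, integral_rpow (Or.inl (by linarith)),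
        ENNReal.ofReal_rpow_of_nonneg hb hs.le, ← ENNReal.ofReal_mul (by positivity)]
      congr 1
      rw [sub_add_cancel, Real.zero_rpow hs.ne', sub_zero, div_eq_mul_inv]
    · filter_upwards [ae_restrict_mem measurableSet_Ioc] with t ht
      exact Real.rpow_nonneg ht.1.le _
  have hm : MeasurableSet {t : ℝ | ENNReal.ofReal t < g} :=
    measurableSet_lt ENNReal.measurable_ofReal measurable_const
  rw [lintegral_indicator hm, Measure.restrict_restrict hm]
  rcases eq_or_ne g ⊤ with rfl | hg
  · rw [ENNReal.top_rpow_of_pos hs, ENNReal.top_mul (by simpa using hs)]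
    have hset : {t : ℝ | ENNReal.ofReal t < ⊤} ∩ Set.Ioi 0 = Set.Ioi 0 := by
      ext t; simp
    rw [hset]
    by_contra hne
    have hle : ∀ n : ℕ, (n : ℝ≥0∞) ^ s * ENNReal.ofReal s⁻¹
        ≤ ∫⁻ t in Set.Ioi (0 : ℝ), ENNReal.ofReal (t ^ (s - 1)) := by
      intro n
      have := key n n.cast_nonneg
      rw [ENNReal.ofReal_natCast] at this
      rw [← this]
      exact lintegral_mono_set Set.Ioo_subset_Ioi_self
    have ht : Filter.Tendsto (fun n : ℕ => (n : ℝ≥0∞) ^ s * ENNReal.ofReal s⁻¹)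
        Filter.atTop (nhds (⊤ ^ s * ENNReal.ofReal s⁻¹)) := by
      apply ENNReal.Tendsto.mul_const
      · exact (ENNReal.continuous_rpow_const.tendsto _).comp ENNReal.tendsto_nat_nhds_top
      · right; simp
    rw [ENNReal.top_rpow_of_pos hs, ENNReal.top_mul (by simpa using hs)] at ht
    exact hne (top_le_iff.1 (le_of_tendsto' ht hle))
  · lift g to NNReal using hg
    have hset : {t : ℝ | ENNReal.ofReal t < g} ∩ Set.Ioi 0 = Set.Ioo 0 (g : ℝ) := by
      ext t
      simp only [Set.mem_inter_iff, Set.mem_ofPred_eq, Set.mem_Ioi, Set.mem_Ioo]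
      rw [and_comm, and_congr_right_iff]
      intro h
      rw [← ENNReal.ofReal_coe_nnreal, ENNReal.ofReal_lt_ofReal_iff_of_nonneg h.le]
    rw [hset, key _ g.coe_nonneg, ENNReal.ofReal_coe_nnreal]

/-! ### The Hardy–Littlewood maximal theorem. -/

namespace IsUpperRegularQuasiMetric

variable {X : Type*} [TopologicalSpace X] [MeasurableSpace X] {μ : Measure X} {d : X → X → ℝ}
  {A c Q : ℝ}

lemma isOpen_ball (h : IsUpperRegularQuasiMetric μ d A c Q) (x : X) (r : ℝ) :
    IsOpen {y | d x y < r} :=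
  isOpen_lt (h.continuous.comp (Continuous.prodMk_right x)) continuous_const

lemma ballAverage_const_le (h : IsUpperRegularQuasiMetric μ d A c Q) (a : ℝ≥0∞) (x : X) {r : ℝ}
    (hr : 0 < r) : ballAverage μ d Q (fun _ => a) x r ≤ ENNReal.ofReal c * a := by
  have hc := h.c_pos
  unfold ballAverage
  rw [setLIntegral_const]
  calc _ ≤ ENNReal.ofReal (r ^ (-Q)) * (a * ENNReal.ofReal (c * r ^ Q)) := by
        gcongr; exact h.measure_ball_le x r hr
    _ = ENNReal.ofReal (r ^ (-Q) * (c * r ^ Q)) * a := by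
        rw [ENNReal.ofReal_mul (p := r ^ (-Q)) (by positivity)]; ring
    _ = _ := by
        congr 2
        rw [mul_left_comm, ← Real.rpow_add hr, neg_add_cancel, Real.rpow_zero, mul_one]

variable [BorelSpace X]

lemma measurableSet_ball (h : IsUpperRegularQuasiMetric μ d A c Q) (x : X) (r : ℝ) :
    MeasurableSet {y | d x y < r} :=
  (h.isOpen_ball x r).measurableSet

variable [SecondCountableTopology X]

lemma measurable_ballAverage [SFinite μ] (h : IsUpperRegularQuasiMetric μ d A c Q)
    {f : X → ℝ≥0∞} (hf : Measurable f) (r : ℝ) :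
    Measurable fun x => ballAverage μ d Q f x r := by
  unfold ballAverage
  refine Measurable.const_mul ?_ _
  have : ∀ x, ∫⁻ y in {y | d x y < r}, f y ∂μ
      = ∫⁻ y, {z : X × X | d z.1 z.2 < r}.indicator (fun z => f z.2) (x, y) ∂μ := by
    intro x
    rw [← lintegral_indicator (h.measurableSet_ball x r)]
    rfl
  simp_rw [this]
  apply Measurable.lintegral_prod_right'
    (f := {z : X × X | d z.1 z.2 < r}.indicator (fun z => f z.2))
  exact (hf.comp measurable_snd).indicator (isOpen_lt h.continuous continuous_const).measurableSet

lemma measurable_dyadicMaximal [SFinite μ] (h : IsUpperRegularQuasiMetric μ d A c Q)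
    {f : X → ℝ≥0∞} (hf : Measurable f) : Measurable (dyadicMaximal μ d Q f) :=
  Measurable.iSup fun _ => h.measurable_ballAverage hf _

/-- The weak type `(1, 1)` bound for the maximal function. -/
lemma measure_dyadicMaximal_gt_le (h : IsUpperRegularQuasiMetric μ d A c Q) (f : X → ℝ≥0∞)
    {t : ℝ} (ht : 0 < t) :
    μ {x | ENNReal.ofReal t < dyadicMaximal μ d Q f x}
      ≤ ENNReal.ofReal (c * (3 * A) ^ Q * t⁻¹) * ∫⁻ y, f y ∂μ := by
  have hA := h.A_pos
  have hc := h.c_pos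
  have hQ := h.Q_pos
  rcases eq_or_ne (∫⁻ y, f y ∂μ) ⊤ with hI | hI
  · rw [hI, ENNReal.mul_top (by simp only [ne_eq, ENNReal.ofReal_eq_zero, not_le]; positivity)]
    exact le_top
  set I := (∫⁻ y, f y ∂μ).toReal with hIdef
  have hI0 : 0 ≤ I := ENNReal.toReal_nonneg
  let T : Set (X × ℤ) := {a | ENNReal.ofReal t < ballAverage μ d Q f a.1 (2 ^ a.2)}
  let B : X × ℤ → Set X := fun a => {y | d a.1 y < 2 ^ a.2}
  have hself : ∀ a, a.1 ∈ B a := fun a => by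
    simp only [B, Set.mem_ofPred_eq, h.self]; positivity
  have hT : ∀ a ∈ T, ENNReal.ofReal (((2 : ℝ) ^ a.2) ^ Q)
      ≤ ENNReal.ofReal t⁻¹ * ∫⁻ y in B a, f y ∂μ := by
    intro a ha
    have h2 : (0 : ℝ) < 2 ^ a.2 := by positivity
    have h1 : ENNReal.ofReal t ≤ ENNReal.ofReal (((2 : ℝ) ^ a.2) ^ (-Q)) * ∫⁻ y in B a, f y ∂μ :=
      le_of_lt ha
    calc ENNReal.ofReal (((2 : ℝ) ^ a.2) ^ Q)
        = ENNReal.ofReal (t⁻¹ * ((2 : ℝ) ^ a.2) ^ Q) * ENNReal.ofReal t := by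
          rw [← ENNReal.ofReal_mul (by positivity)]; congr 1; field_simp
      _ ≤ ENNReal.ofReal (t⁻¹ * ((2 : ℝ) ^ a.2) ^ Q)
          * (ENNReal.ofReal (((2 : ℝ) ^ a.2) ^ (-Q)) * ∫⁻ y in B a, f y ∂μ) := by gcongr
      _ = _ := by
          rw [← mul_assoc, ← ENNReal.ofReal_mul (by positivity), mul_assoc,
            ← Real.rpow_add h2, add_neg_cancel, Real.rpow_zero, mul_one]
  -- Balls are indexed by centre and dyadic exponent. A selected ball has `r ^ Q ≤ t⁻¹ * I`, which
  -- bounds the radii as Vitali's lemma requires. Every ball of `T` meets a chosen one of at least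
  -- half its radius, so its centre lies within `A * (1 + 2) = 3 * A` chosen radii.
  obtain ⟨u, huT, hdisj, hcov⟩ := Vitali.exists_disjoint_subfamily_covering_enlargement B T
    (fun a => (2 : ℝ) ^ a.2) 2 one_lt_two (fun a _ => by positivity) ((t⁻¹ * I) ^ Q⁻¹)
    (fun a ha => by
      have h2 : (0 : ℝ) < 2 ^ a.2 := by positivity
      have h1 : ENNReal.ofReal (((2 : ℝ) ^ a.2) ^ Q) ≤ ENNReal.ofReal (t⁻¹ * I) := by
        rw [ENNReal.ofReal_mul (by positivity), hIdef, ENNReal.ofReal_toReal hI]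
        exact (hT a ha).trans (by gcongr; exact Measure.restrict_le_self)
      rw [ENNReal.ofReal_le_ofReal_iff (by positivity)] at h1
      exact (Real.le_rpow_inv_iff_of_pos h2.le (by positivity) hQ).2 h1)
    (fun a _ => ⟨a.1, hself a⟩)
  have hucount : u.Countable :=
    hdisj.countable_of_isOpen (fun a _ => h.isOpen_ball _ _) (fun a _ => ⟨a.1, hself a⟩)
  have hsub : {x | ENNReal.ofReal t < dyadicMaximal μ d Q f x}
      ⊆ ⋃ b ∈ u, {y | d b.1 y < 3 * A * 2 ^ b.2} := by
    intro x hx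
    obtain ⟨k, hk⟩ := lt_iSup_iff.1 (show ENNReal.ofReal t < ⨆ k : ℤ, _ from hx)
    obtain ⟨b, hb, ⟨z, hza, hzb⟩, hle⟩ := hcov (x, k) hk
    simp only [B, Set.mem_ofPred_eq] at hza hzb hle
    refine Set.mem_biUnion hb ?_
    have := h.triangle b.1 z x
    rw [h.symm z x] at this
    simp only [Set.mem_ofPred_eq]
    calc d b.1 x ≤ A * (d b.1 z + d x z) := this
      _ < A * (2 ^ b.2 + 2 * 2 ^ b.2) := by gcongr; exact hza.trans_le hle
      _ = _ := by ring
  calc μ {x | ENNReal.ofReal t < dyadicMaximal μ d Q f x}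
      ≤ μ (⋃ b ∈ u, {y | d b.1 y < 3 * A * 2 ^ b.2}) := measure_mono hsub
    _ ≤ ∑' b : u, μ {y | d b.1.1 y < 3 * A * 2 ^ b.1.2} := measure_biUnion_le μ hucount _
    _ ≤ ∑' b : u, ENNReal.ofReal (c * (3 * A) ^ Q * t⁻¹) * ∫⁻ y in B b, f y ∂μ := by
        refine ENNReal.tsum_le_tsum fun b => (h.measure_ball_le _ _ (by positivity)).trans ?_
        rw [Real.mul_rpow (by positivity) (by positivity), ← mul_assoc,
          ENNReal.ofReal_mul (by positivity),
          ENNReal.ofReal_mul (p := c * (3 * A) ^ Q) (by positivity), mul_assoc]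
        gcongr
        exact hT _ (huT b.2)
    _ = ENNReal.ofReal (c * (3 * A) ^ Q * t⁻¹) * ∫⁻ y in ⋃ b ∈ u, B b, f y ∂μ := by
        rw [ENNReal.tsum_mul_left,
          lintegral_biUnion hucount (fun b _ => h.measurableSet_ball _ _) hdisj]
    _ ≤ _ := by gcongr; exact Measure.restrict_le_self

/-- The weak type bound with the integral restricted to the points where `f` is large. -/
lemma measure_dyadicMaximal_gt_le_restrict (h : IsUpperRegularQuasiMetric μ d A c Q)
    (f : X → ℝ≥0∞) {t : ℝ} (ht : 0 < t) :
    μ {x | ENNReal.ofReal t < dyadicMaximal μ d Q f x}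
      ≤ ENNReal.ofReal (2 * c * (3 * A) ^ Q * t⁻¹)
        * ∫⁻ y, {y | ENNReal.ofReal t < ENNReal.ofReal (2 * c) * f y}.indicator f y ∂μ := by
  have hc := h.c_pos
  set g := {y | ENNReal.ofReal t < ENNReal.ofReal (2 * c) * f y}.indicator f with hg
  -- Where `g` vanishes, `f` is at most `t / (2 * c)`, and the averages of that constant are at most
  -- `t / 2`. So `M f > t` forces `M g > t / 2`.
  have hfg : ∀ y, f y ≤ g y + ENNReal.ofReal (t / (2 * c)) := by
    intro y
    by_cases hy : ENNReal.ofReal t < ENNReal.ofReal (2 * c) * f y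
    · rw [hg, Set.indicator_of_mem (by exact hy)]; exact le_self_add
    · rw [ENNReal.ofReal_div_of_pos (by positivity)]
      refine le_trans ?_ le_add_self
      rw [ENNReal.le_div_iff_mul_le (by left; simpa using hc) (by left; exact ENNReal.ofReal_ne_top),
        mul_comm]
      exact not_lt.1 hy
  have hsub : {x | ENNReal.ofReal t < dyadicMaximal μ d Q f x}
      ⊆ {x | ENNReal.ofReal (t / 2) < dyadicMaximal μ d Q g x} := by
    intro x hx
    simp only [Set.mem_ofPred_eq] at hx ⊢
    by_contra! hle
    refine absurd hx (not_lt.2 (iSup_le fun k => ?_))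
    have hk : ballAverage μ d Q g x (2 ^ k) ≤ ENNReal.ofReal (t / 2) :=
      (le_iSup (fun k : ℤ => ballAverage μ d Q g x (2 ^ k)) k).trans hle
    calc ballAverage μ d Q f x (2 ^ k)
        ≤ ballAverage μ d Q g x (2 ^ k)
          + ballAverage μ d Q (fun _ => ENNReal.ofReal (t / (2 * c))) x (2 ^ k) := by
          unfold ballAverage
          rw [← mul_add, ← lintegral_add_right _ measurable_const]
          gcongr with y
          exact hfg y
      _ ≤ ENNReal.ofReal (t / 2) + ENNReal.ofReal c * ENNReal.ofReal (t / (2 * c)) := by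
          gcongr; exact h.ballAverage_const_le _ _ (by positivity)
      _ = ENNReal.ofReal t := by
          rw [← ENNReal.ofReal_mul hc.le, ← ENNReal.ofReal_add (by positivity) (by positivity)]
          congr 1; field_simp; norm_num
  refine (measure_mono hsub).trans ((h.measure_dyadicMaximal_gt_le g (half_pos ht)).trans_eq ?_)
  congr 2
  field_simp

/-- The Hardy–Littlewood maximal theorem in `L^p`, `p > 1`. -/
theorem lintegral_dyadicMaximal_rpow_le [SFinite μ] (h : IsUpperRegularQuasiMetric μ d A c Q)
    {p : ℝ} (hp : 1 < p) :
    ∃ C : ℝ, 0 < C ∧ ∀ f : X → ℝ≥0∞, Measurable f →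
      ∫⁻ x, dyadicMaximal μ d Q f x ^ p ∂μ ≤ ENNReal.ofReal C * ∫⁻ x, f x ^ p ∂μ := by
  have hc := h.c_pos
  have hA := h.A_pos
  have hp0 : 0 < p := by linarith
  have hp1 : 0 < p - 1 := by linarith
  set K := 2 * c * (3 * A) ^ Q with hK
  have hK0 : 0 < K := by positivity
  -- `p` comes from the layer-cake formula, `K` from the truncated weak type bound, and the rest
  -- from integrating `t ^ (p - 2)` over `0 < t < 2 * c * f x`, where `p > 1` is needed.
  refine ⟨p * K * ((2 * c) ^ (p - 1) * (p - 1)⁻¹), by positivity, fun f hf => ?_⟩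
  have hM := h.measurable_dyadicMaximal hf
  have hpt : ∀ x, dyadicMaximal μ d Q f x ^ p = ENNReal.ofReal p *
      ∫⁻ t in Set.Ioi (0 : ℝ), {t | ENNReal.ofReal t < dyadicMaximal μ d Q f x}.indicator
      (fun t => ENNReal.ofReal (t ^ (p - 1))) t := by
    intro x
    rw [lintegral_Ioi_indicator_rpow _ hp0, mul_left_comm, ← ENNReal.ofReal_mul hp0.le,
      mul_inv_cancel₀ hp0.ne', ENNReal.ofReal_one, mul_one]
  have hmeas1 : Measurable (Function.uncurry fun (x : X) (t : ℝ) =>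
      {t | ENNReal.ofReal t < dyadicMaximal μ d Q f x}.indicator
      (fun t => ENNReal.ofReal (t ^ (p - 1))) t) := by
    have : MeasurableSet {z : X × ℝ | ENNReal.ofReal z.2 < dyadicMaximal μ d Q f z.1} :=
      measurableSet_lt (ENNReal.measurable_ofReal.comp measurable_snd) (hM.comp measurable_fst)
    exact (show Measurable fun z : X × ℝ => ENNReal.ofReal (z.2 ^ (p - 1)) by fun_prop).indicator
      this
  have hmeas2 : Measurable (Function.uncurry fun (t : ℝ) (x : X) =>
      ENNReal.ofReal (t ^ (p - 1 - 1)) *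
        {y | ENNReal.ofReal t < ENNReal.ofReal (2 * c) * f y}.indicator f x) := by
    have : MeasurableSet {z : ℝ × X | ENNReal.ofReal z.1 < ENNReal.ofReal (2 * c) * f z.2} :=
      measurableSet_lt (ENNReal.measurable_ofReal.comp measurable_fst)
        ((hf.comp measurable_snd).const_mul _)
    exact (show Measurable fun z : ℝ × X => ENNReal.ofReal (z.1 ^ (p - 1 - 1)) by fun_prop).mul
      ((hf.comp measurable_snd).indicator this)
  simp_rw [hpt]
  rw [lintegral_const_mul _ (hmeas1.lintegral_prod_right (ν := volume.restrict (Set.Ioi 0))),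
    lintegral_lintegral_swap hmeas1.aemeasurable]
  calc _ ≤ ENNReal.ofReal p * ∫⁻ t in Set.Ioi (0 : ℝ), ENNReal.ofReal K *
        ∫⁻ x, ENNReal.ofReal (t ^ (p - 1 - 1)) *
        {y | ENNReal.ofReal t < ENNReal.ofReal (2 * c) * f y}.indicator f x ∂μ := by
        gcongr ENNReal.ofReal p * ?_
        refine setLIntegral_mono' measurableSet_Ioi fun t ht => ?_
        have ht : 0 < t := ht
        have hset : MeasurableSet {x | ENNReal.ofReal t < dyadicMaximal μ d Q f x} :=
          measurableSet_lt measurable_const hM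
        have : ∫⁻ x, {t | ENNReal.ofReal t < dyadicMaximal μ d Q f x}.indicator
            (fun t => ENNReal.ofReal (t ^ (p - 1))) t ∂μ
            = ENNReal.ofReal (t ^ (p - 1)) *
              μ {x | ENNReal.ofReal t < dyadicMaximal μ d Q f x} := by
          rw [← lintegral_indicator_const hset]; rfl
        rw [this, lintegral_const_mul _ (hf.indicator (measurableSet_lt measurable_const
          (hf.const_mul _))), ← mul_assoc]
        refine (mul_le_mul_right (h.measure_dyadicMaximal_gt_le_restrict f ht) _).trans_eq ?_
        rw [← mul_assoc, ← ENNReal.ofReal_mul (by positivity), ← ENNReal.ofReal_mul hK0.le]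
        congr 2
        rw [Real.rpow_sub_one ht.ne' (p - 1)]
        ring
    _ = ENNReal.ofReal (p * K) * ∫⁻ x, f x * ((ENNReal.ofReal (2 * c) * f x) ^ (p - 1)
          * ENNReal.ofReal (p - 1)⁻¹) ∂μ := by
        rw [lintegral_const_mul _ (hmeas2.lintegral_prod_right (ν := μ)), ← mul_assoc,
          ← ENNReal.ofReal_mul hp0.le, lintegral_lintegral_swap hmeas2.aemeasurable]
        congr 2
        ext x
        rw [← lintegral_Ioi_indicator_rpow _ hp1, ← lintegral_const_mul]
        · refine lintegral_congr fun t => ?_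
          by_cases ht : ENNReal.ofReal t < ENNReal.ofReal (2 * c) * f x
          · rw [Set.indicator_of_mem (by exact ht), Set.indicator_of_mem (by exact ht), mul_comm]
          · rw [Set.indicator_of_notMem (by exact ht), Set.indicator_of_notMem (by exact ht),
              mul_zero, mul_zero]
        · exact (show Measurable fun t : ℝ => ENNReal.ofReal (t ^ (p - 1 - 1)) by
            fun_prop).indicator (measurableSet_lt ENNReal.measurable_ofReal measurable_const)
    _ = _ := by
        rw [ENNReal.ofReal_mul (p := p * K) (by positivity), mul_assoc]
        congr 1
        rw [← lintegral_const_mul _ (hf.pow_const p)]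
        refine lintegral_congr fun x => ?_
        rw [ENNReal.mul_rpow_of_nonneg _ _ hp1.le, ENNReal.ofReal_rpow_of_pos (by positivity),
          ENNReal.ofReal_mul (by positivity)]
        have : f x ^ p = f x * f x ^ (p - 1) := by
          nth_rewrite 2 [← ENNReal.rpow_one (f x)]
          rw [← ENNReal.rpow_add_of_nonneg _ _ zero_le_one hp1.le, add_sub_cancel]
        rw [this]
        ring

end IsUpperRegularQuasiMetric

/-! ### Dyadic sums and dyadic decomposition of the kernel. -/

lemma summable_pow_natAbs {θ : ℝ} (h0 : 0 ≤ θ) (h1 : θ < 1) :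
    Summable fun j : ℤ => θ ^ j.natAbs := by
  refine Summable.of_nat_of_neg ?_ ?_
  · simpa using summable_geometric_of_lt_one h0 h1
  · simpa using summable_geometric_of_lt_one h0 h1

/-- Optimising a dyadic sum whose terms admit two competing bounds. -/
lemma exists_tsum_dyadic_le {γ β : ℝ} (hγ : 0 < γ) (hγβ : γ < β) :
    ∃ S : ℝ, 0 < S ∧ ∀ (m a : ℝ) (v : ℤ → ℝ≥0∞), 0 < m → 0 < a →
      (∀ k, v k ≤ ENNReal.ofReal m) → (∀ k, v k ≤ ENNReal.ofReal (a * ((2 : ℝ) ^ k) ^ (-β))) →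
      ∑' k : ℤ, ENNReal.ofReal (((2 : ℝ) ^ k) ^ γ) * v k
        ≤ ENNReal.ofReal (S * (a ^ (γ / β) * m ^ (1 - γ / β))) := by
  have hβ : 0 < β := hγ.trans hγβ
  set θ : ℝ := max (2 ^ (-γ)) (2 ^ (γ - β)) with hθ
  have hθ0 : 0 < θ := lt_max_of_lt_left (by positivity)
  have hθ1 : θ < 1 := max_lt (Real.rpow_lt_one_of_one_lt_of_neg one_lt_two (by linarith))
    (Real.rpow_lt_one_of_one_lt_of_neg one_lt_two (by linarith))
  have hsum := summable_pow_natAbs hθ0.le hθ1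
  have hS : 0 < ∑' j : ℤ, θ ^ j.natAbs := hsum.tsum_pos (fun j => by positivity) 0 (by positivity)
  refine ⟨2 ^ (β - γ) * ∑' j : ℤ, θ ^ j.natAbs, by positivity, fun m a v hm ha hv1 hv2 => ?_⟩
  set T := a ^ (γ / β) * m ^ (1 - γ / β) with hT
  have hT0 : 0 < T := by positivity
  -- The scale at which the two bounds coincide: `m = a * R ^ (-β)`, so both products below equal
  -- `T`.
  set R := (a / m) ^ β⁻¹ with hR
  have hR0 : 0 < R := by positivity
  have hRpow : ∀ s : ℝ, R ^ s = a ^ (s / β) * m ^ (-(s / β)) := fun s => by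
    rw [hR, ← Real.rpow_mul (by positivity), Real.div_rpow ha.le hm.le, Real.rpow_neg hm.le,
      div_eq_mul_inv, inv_mul_eq_div]
  have hT1 : m * R ^ γ = T := by
    rw [hRpow, hT, Real.rpow_sub hm, Real.rpow_one, Real.rpow_neg hm.le]; ring
  have hT2 : a * R ^ (γ - β) = T := by
    rw [hRpow, hT, sub_div, div_self hβ.ne', Real.rpow_sub ha, Real.rpow_one, neg_sub]
    field_simp
  -- The sum is recentred at the dyadic scale just below `R`. Terms then decay geometrically on both
  -- sides; the factor `2 ^ (β - γ)` pays for knowing only `2 ^ n > R / 2`.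
  obtain ⟨n, hn1, hn2⟩ := exists_mem_Ico_zpow hR0 (one_lt_two (α := ℝ))
  have h2γ : (1 : ℝ) ≤ 2 ^ (β - γ) := Real.one_le_rpow one_le_two (by linarith)
  have hzpow : ∀ (k : ℤ) (s : ℝ), ((2 : ℝ) ^ k) ^ s = (2 ^ s) ^ k := fun k s => by
    rw [← Real.rpow_intCast, ← Real.rpow_intCast, ← Real.rpow_mul two_pos.le,
      ← Real.rpow_mul two_pos.le, mul_comm]
  have hterm : ∀ j : ℤ, ENNReal.ofReal (((2 : ℝ) ^ (n + j)) ^ γ) * v (n + j)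
      ≤ ENNReal.ofReal (T * 2 ^ (β - γ) * θ ^ j.natAbs) := by
    intro j
    obtain ⟨i, rfl | rfl⟩ := j.eq_nat_or_neg
    · refine (mul_le_mul_right (hv2 _) _).trans ?_
      rw [← ENNReal.ofReal_mul (by positivity), Int.natAbs_natCast]
      refine ENNReal.ofReal_le_ofReal ?_
      calc ((2 : ℝ) ^ (n + (i : ℤ))) ^ γ * (a * ((2 : ℝ) ^ (n + (i : ℤ))) ^ (-β))
          = a * ((2 : ℝ) ^ (n + (i : ℤ))) ^ (γ - β) := by
            rw [sub_eq_add_neg, Real.rpow_add (by positivity)]; ring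
        _ = a * ((2 : ℝ) ^ n) ^ (γ - β) * (2 ^ (γ - β)) ^ i := by
            rw [zpow_add₀ two_ne_zero, Real.mul_rpow (by positivity) (by positivity),
              hzpow (i : ℤ), zpow_natCast, mul_assoc]
        _ ≤ a * (R / 2) ^ (γ - β) * θ ^ i := by
            have h1 : ((2 : ℝ) ^ n) ^ (γ - β) ≤ (R / 2) ^ (γ - β) := by
              refine Real.rpow_le_rpow_of_nonpos (by positivity) ?_ (by linarith)
              rw [zpow_add₀ two_ne_zero, zpow_one] at hn2
              linarith
            gcongr
            exact le_max_right _ _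
        _ = T * 2 ^ (β - γ) * θ ^ i := by
            rw [Real.div_rpow hR0.le two_pos.le, ← hT2, div_eq_mul_inv,
              ← Real.rpow_neg two_pos.le, neg_sub]; ring
    · refine (mul_le_mul_right (hv1 _) _).trans ?_
      rw [← ENNReal.ofReal_mul (by positivity), Int.natAbs_neg, Int.natAbs_natCast]
      refine ENNReal.ofReal_le_ofReal ?_
      calc ((2 : ℝ) ^ (n + -(i : ℤ))) ^ γ * m
          = m * ((2 : ℝ) ^ n) ^ γ * (2 ^ (-γ)) ^ i := by
            rw [zpow_add₀ two_ne_zero, Real.mul_rpow (by positivity) (by positivity),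
              hzpow (-(i : ℤ)), zpow_neg, zpow_natCast, Real.rpow_neg two_pos.le, inv_pow]
            ring
        _ ≤ m * R ^ γ * θ ^ i := by
            gcongr
            exact le_max_left _ _
        _ ≤ T * 2 ^ (β - γ) * θ ^ i := by
            rw [hT1]
            gcongr
            exact le_mul_of_one_le_right hT0.le h2γ
  calc _ = ∑' j : ℤ, ENNReal.ofReal (((2 : ℝ) ^ (n + j)) ^ γ) * v (n + j) :=
        ((Equiv.addLeft n).tsum_eq fun k : ℤ => ENNReal.ofReal (((2 : ℝ) ^ k) ^ γ) * v k).symm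
    _ ≤ ∑' j : ℤ, ENNReal.ofReal (T * 2 ^ (β - γ) * θ ^ j.natAbs) := ENNReal.tsum_le_tsum hterm
    _ = ENNReal.ofReal (∑' j : ℤ, T * 2 ^ (β - γ) * θ ^ j.natAbs) :=
        (ENNReal.ofReal_tsum_of_nonneg (fun j => by positivity) (hsum.mul_left _)).symm
    _ = _ := by rw [tsum_mul_left]; congr 1; ring

lemma ofReal_rpow_le_tsum_indicator (ρ : ℝ) {s : ℝ} (hρ : 0 ≤ ρ) (hs : s < 0) :
    ENNReal.ofReal (ρ ^ s) ≤ ∑' k : ℤ, {r : ℝ | ρ < r}.indicator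
      (fun _ => ENNReal.ofReal (2 ^ (-s) * ((2 : ℝ) ^ k) ^ s)) ((2 : ℝ) ^ k) := by
  -- At `ρ = 0` the real power `0 ^ s` is `0` for `s ≠ 0`, so the singular point costs nothing.
  rcases hρ.eq_or_lt with rfl | hρ
  · simp [Real.zero_rpow hs.ne]
  · obtain ⟨k, hk1, hk2⟩ := exists_mem_Ico_zpow hρ (one_lt_two (α := ℝ))
    -- With `2 ^ k ≤ ρ < 2 ^ (k + 1)`, the single term `k + 1` suffices: the factor `2 ^ (-s)` turns
    -- it into `(2 ^ k) ^ s`.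
    refine le_trans ?_ (ENNReal.le_tsum (k + 1))
    rw [Set.indicator_of_mem (by exact hk2), zpow_add₀ two_ne_zero, zpow_one,
      Real.mul_rpow (by positivity) two_pos.le, mul_left_comm, ← Real.rpow_add two_pos,
      neg_add_cancel, Real.rpow_zero, mul_one]
    exact ENNReal.ofReal_le_ofReal (Real.rpow_le_rpow_of_nonpos (by positivity) hk1 hs.le)

/-! ### Hedberg's inequality and the Morrey bound. -/

namespace IsUpperRegularQuasiMetric

variable {X : Type*} [TopologicalSpace X] [MeasurableSpace X] {μ : Measure X} {d : X → X → ℝ}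
  {A c Q : ℝ}

/-- Hölder's inequality on balls for functions in a Morrey space. -/
lemma ballAverage_le_of_morrey (h : IsUpperRegularQuasiMetric μ d A c Q) {p lam a : ℝ}
    (hp : 1 < p) (ha : 0 < a) {f : X → ℝ≥0∞} (hf : Measurable f)
    (hM : ∀ x r, 0 < r → ∫⁻ y in {y | d x y < r}, f y ^ p ∂μ ≤ ENNReal.ofReal (a ^ p * r ^ lam))
    (x : X) {r : ℝ} (hr : 0 < r) :
    ballAverage μ d Q f x r ≤ ENNReal.ofReal (c ^ (1 - 1 / p) * a * r ^ (-((Q - lam) / p))) := by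
  have hc := h.c_pos
  have hp0 : 0 < p := by linarith
  have hpq := Real.HolderConjugate.conjExponent hp
  have hq : 1 / p.conjExponent = 1 - 1 / p := by
    rw [one_div, one_div, hpq.one_sub_inv]
  have hq0 : 0 ≤ 1 - 1 / p := by rw [← hq]; exact (one_div_pos.2 hpq.symm.pos).le
  have h1 := ENNReal.lintegral_mul_le_Lp_mul_Lq (μ.restrict {y | d x y < r}) hpq
    hf.aemeasurable (aemeasurable_const (b := (1 : ℝ≥0∞)))
  simp only [Pi.mul_apply, mul_one, ENNReal.one_rpow, lintegral_one, Measure.restrict_apply_univ,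
    hq] at h1
  unfold ballAverage
  calc _ ≤ ENNReal.ofReal (r ^ (-Q)) * (ENNReal.ofReal (a ^ p * r ^ lam) ^ (1 / p)
        * ENNReal.ofReal (c * r ^ Q) ^ (1 - 1 / p)) := by
        refine mul_le_mul_right (h1.trans ?_) _
        gcongr
        · exact hM x r hr
        · exact h.measure_ball_le x r hr
    _ = _ := by
        rw [ENNReal.ofReal_rpow_of_pos (by positivity), ENNReal.ofReal_rpow_of_pos (by positivity),
          ← ENNReal.ofReal_mul (by positivity), ← ENNReal.ofReal_mul (by positivity)]
        congr 1
        rw [Real.mul_rpow (by positivity) (by positivity),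
          Real.mul_rpow (by positivity) (by positivity), ← Real.rpow_mul ha.le,
          ← Real.rpow_mul hr.le, ← Real.rpow_mul hr.le, mul_one_div_cancel hp0.ne', Real.rpow_one]
        have : r ^ (-((Q - lam) / p)) = r ^ (-Q) * r ^ (lam * (1 / p)) * r ^ (Q * (1 - 1 / p)) := by
          rw [← Real.rpow_add hr, ← Real.rpow_add hr]
          congr 1
          ring
        rw [this]
        ring

variable [BorelSpace X]

lemma lintegral_kernel_le_tsum (h : IsUpperRegularQuasiMetric μ d A c Q) {γ : ℝ} (hγQ : γ < Q)
    {f : X → ℝ≥0∞} (hf : Measurable f) (x : X) :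
    ∫⁻ y, ENNReal.ofReal (d x y ^ (γ - Q)) * f y ∂μ
      ≤ ENNReal.ofReal (2 ^ (Q - γ)) *
        ∑' k : ℤ, ENNReal.ofReal (((2 : ℝ) ^ k) ^ γ) * ballAverage μ d Q f x (2 ^ k) := by
  have hm : ∀ k : ℤ, Measurable fun y => {y | d x y < 2 ^ k}.indicator f y := fun k =>
    hf.indicator (h.measurableSet_ball x _)
  calc _ ≤ ∫⁻ y, ∑' k : ℤ, ENNReal.ofReal (2 ^ (Q - γ) * ((2 : ℝ) ^ k) ^ (γ - Q)) *
        {y | d x y < 2 ^ k}.indicator f y ∂μ := by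
        refine lintegral_mono fun y => ?_
        refine (mul_le_mul_left (ofReal_rpow_le_tsum_indicator _ (h.nonneg x y)
          (sub_neg.2 hγQ)) _).trans_eq ?_
        rw [← ENNReal.tsum_mul_right, neg_sub]
        refine tsum_congr fun k => ?_
        by_cases hk : d x y < 2 ^ k
        · rw [Set.indicator_of_mem (by exact hk), Set.indicator_of_mem (by exact hk)]
        · rw [Set.indicator_of_notMem (by exact hk), Set.indicator_of_notMem (by exact hk),
            zero_mul, mul_zero]
    _ = _ := by
        rw [lintegral_tsum fun k => ((hm k).const_mul _).aemeasurable, ← ENNReal.tsum_mul_left]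
        refine tsum_congr fun k => ?_
        rw [lintegral_const_mul _ (hm k), lintegral_indicator (h.measurableSet_ball x _),
          ballAverage, ENNReal.ofReal_mul (by positivity), sub_eq_add_neg γ,
          Real.rpow_add (by positivity), ENNReal.ofReal_mul (by positivity)]
        ring

/-- Hedberg's pointwise bound of the Riesz potential of a Morrey function by its maximal
function. -/
lemma exists_lintegral_kernel_le (h : IsUpperRegularQuasiMetric μ d A c Q) {γ p lam : ℝ}
    (hγ : 0 < γ) (hγQ : γ < Q) (hp : 1 < p) (hγp : γ < (Q - lam) / p) :
    ∃ C : ℝ, 0 < C ∧ ∀ (f : X → ℝ≥0∞) (a m : ℝ) (x : X), Measurable f → 0 < a → 0 < m →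
      (∀ x r, 0 < r →
        ∫⁻ y in {y | d x y < r}, f y ^ p ∂μ ≤ ENNReal.ofReal (a ^ p * r ^ lam)) →
      dyadicMaximal μ d Q f x ≤ ENNReal.ofReal m →
      ∫⁻ y, ENNReal.ofReal (d x y ^ (γ - Q)) * f y ∂μ ≤ ENNReal.ofReal
        (C * (a ^ (γ / ((Q - lam) / p)) * m ^ (1 - γ / ((Q - lam) / p)))) := by
  have hc := h.c_pos
  set β := (Q - lam) / p with hβ
  obtain ⟨S, hS, hsum⟩ := exists_tsum_dyadic_le hγ hγp
  refine ⟨2 ^ (Q - γ) * (S * (c ^ (1 - 1 / p)) ^ (γ / β)), by positivity,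
    fun f a m x hf ha hm hM hmax => ?_⟩
  refine (h.lintegral_kernel_le_tsum hγQ hf x).trans ?_
  refine (mul_le_mul_right (hsum m (c ^ (1 - 1 / p) * a) _ hm (by positivity)
    (fun k => (le_iSup (fun k : ℤ => ballAverage μ d Q f x (2 ^ k)) k).trans hmax)
    (fun k => h.ballAverage_le_of_morrey hp ha hf hM x (by positivity))) _).trans_eq ?_
  rw [← ENNReal.ofReal_mul (by positivity), Real.mul_rpow (by positivity) ha.le]
  congr 1
  ring

/-- Hedberg's bound raised to the power `q`: the relation between `p` and `q` says exactly that `(1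
- γ / β) * q = p` for `β = (Q - lam) / p`, so the maximal function appears with the exponent of its
`L^p` theorem. -/
lemma exists_lintegral_kernel_rpow_le (h : IsUpperRegularQuasiMetric μ d A c Q) {γ p q lam : ℝ}
    (hγ : 0 < γ) (hγQ : γ < Q) (hp : 1 < p) (hγp : γ < (Q - lam) / p) (hq0 : 0 < q)
    (hq : 1 / q = 1 / p - γ / (Q - lam)) :
    ∃ C : ℝ, 0 < C ∧ ∀ (f : X → ℝ≥0∞) (a : ℝ), Measurable f → 0 < a →
      (∀ x r, 0 < r →
        ∫⁻ y in {y | d x y < r}, f y ^ p ∂μ ≤ ENNReal.ofReal (a ^ p * r ^ lam)) →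
      ∀ x, (∫⁻ y, ENNReal.ofReal (d x y ^ (γ - Q)) * f y ∂μ) ^ q
        ≤ ENNReal.ofReal (C * a ^ (q - p)) * dyadicMaximal μ d Q f x ^ p := by
  obtain ⟨C, hC, hmain⟩ := h.exists_lintegral_kernel_le hγ hγQ hp hγp
  have hp0 : 0 < p := by linarith
  have hQl : Q - lam ≠ 0 := by
    rintro h0; rw [h0, zero_div] at hγp; linarith
  have he1 : (1 - γ / ((Q - lam) / p)) * q = p := by
    have : 1 - γ / ((Q - lam) / p) = p * (1 / q) := by rw [hq]; field_simp
    rw [this]; field_simp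
  have he2 : γ / ((Q - lam) / p) * q = q - p := by linarith
  refine ⟨C ^ q, by positivity, fun f a hf ha hM x => ?_⟩
  have hfin : ∀ m : ℝ, 0 < m → dyadicMaximal μ d Q f x ≤ ENNReal.ofReal m →
      (∫⁻ y, ENNReal.ofReal (d x y ^ (γ - Q)) * f y ∂μ) ^ q
        ≤ ENNReal.ofReal (C ^ q * a ^ (q - p)) * ENNReal.ofReal m ^ p := by
    intro m hm hmax
    refine (ENNReal.rpow_le_rpow (hmain f a m x hf ha hm hM hmax) hq0.le).trans_eq ?_
    rw [ENNReal.ofReal_rpow_of_pos (by positivity), ENNReal.ofReal_rpow_of_pos hm,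
      ← ENNReal.ofReal_mul (by positivity), Real.mul_rpow hC.le (by positivity),
      Real.mul_rpow (by positivity) (by positivity), ← Real.rpow_mul ha.le, ← Real.rpow_mul hm.le,
      he1, he2, mul_assoc]
  rcases eq_or_ne (dyadicMaximal μ d Q f x) ⊤ with htop | htop
  · rw [htop, ENNReal.top_rpow_of_pos hp0, ENNReal.mul_top
      (by simp only [ne_eq, ENNReal.ofReal_eq_zero, not_le]; positivity)]
    exact le_top
  · set M := (dyadicMaximal μ d Q f x).toReal with hMdef
    have hMof : dyadicMaximal μ d Q f x = ENNReal.ofReal M := (ENNReal.ofReal_toReal htop).symm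
    have hcont : Continuous fun m : ℝ =>
        ENNReal.ofReal (C ^ q * a ^ (q - p)) * ENNReal.ofReal m ^ p :=
      (ENNReal.continuous_const_mul ENNReal.ofReal_ne_top).comp
        (ENNReal.continuous_rpow_const.comp ENNReal.continuous_ofReal)
    rw [hMof]
    -- Hedberg's bound was proved for positive `m` only; letting `m` decrease to `M` also covers `M
    -- = 0`.
    refine ge_of_tendsto ((hcont.tendsto M).mono_left (nhdsWithin_le_nhds (s := Set.Ioi M))) ?_
    filter_upwards [self_mem_nhdsWithin] with m hm
    exact hfin m (ENNReal.toReal_nonneg.trans_lt hm)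
      (hMof.trans_le (ENNReal.ofReal_le_ofReal (le_of_lt hm)))

/-- On a ball, the maximal function of a Morrey function is controlled by its local part. -/
lemma dyadicMaximal_le_local_add (h : IsUpperRegularQuasiMetric μ d A c Q) {p lam a : ℝ}
    (hp : 1 < p) (hlam : lam < Q) (ha : 0 < a) {f : X → ℝ≥0∞} (hf : Measurable f)
    (hM : ∀ x r, 0 < r → ∫⁻ y in {y | d x y < r}, f y ^ p ∂μ ≤ ENNReal.ofReal (a ^ p * r ^ lam))
    {x₀ x : X} {r : ℝ} (hr : 0 < r) (hx : d x₀ x < r) :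
    dyadicMaximal μ d Q f x ≤ dyadicMaximal μ d Q ({y | d x₀ y < 2 * A * r}.indicator f) x
      + ENNReal.ofReal (c ^ (1 - 1 / p) * a * r ^ (-((Q - lam) / p))) := by
  have hc := h.c_pos
  refine iSup_le fun k => ?_
  -- A ball about `x` of radius at most `r` stays inside the ball about `x₀` of radius `2 * A * r`.
  -- For larger radii the Hölder bound decreases in the radius.
  rcases le_or_gt ((2 : ℝ) ^ k) r with hk | hk
  · refine le_trans ?_ le_self_add
    refine le_trans ?_ (le_iSup (fun k : ℤ => ballAverage μ d Q
      ({y | d x₀ y < 2 * A * r}.indicator f) x (2 ^ k)) k)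
    unfold ballAverage
    refine mul_le_mul_right (setLIntegral_mono' (h.measurableSet_ball _ _) fun y hy => ?_) _
    have hy : d x y < 2 ^ k := hy
    rw [Set.indicator_of_mem]
    have hA := h.A_pos
    calc d x₀ y ≤ A * (d x₀ x + d x y) := h.triangle _ _ _
      _ < A * (r + r) := by gcongr; exact hy.trans_le hk
      _ = _ := by ring
  · refine le_trans ?_ le_add_self
    refine (h.ballAverage_le_of_morrey hp ha hf hM x (by positivity)).trans ?_
    refine ENNReal.ofReal_le_ofReal (mul_le_mul_of_nonneg_left ?_ (by positivity))
    refine Real.rpow_le_rpow_of_nonpos hr hk.le ?_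
    exact neg_nonpos.2 (div_nonneg (by linarith) (by linarith))

/-- The Morrey space bound for the Riesz potential on an upper regular quasi-metric space. -/
theorem exists_setLIntegral_kernel_rpow_le [SecondCountableTopology X] [SFinite μ]
    (h : IsUpperRegularQuasiMetric μ d A c Q) {γ p q lam : ℝ}
    (hγ : 0 < γ) (hγQ : γ < Q) (hp : 1 < p) (hγp : γ < (Q - lam) / p) (hq0 : 0 < q)
    (hq : 1 / q = 1 / p - γ / (Q - lam)) :
    ∃ C : ℝ, 0 < C ∧ ∀ (f : X → ℝ≥0∞) (a : ℝ), Measurable f → 0 < a →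
      (∀ x r, 0 < r →
        ∫⁻ y in {y | d x y < r}, f y ^ p ∂μ ≤ ENNReal.ofReal (a ^ p * r ^ lam)) →
      ∀ x₀ r, 0 < r →
        ∫⁻ x in {x | d x₀ x < r}, (∫⁻ y, ENNReal.ofReal (d x y ^ (γ - Q)) * f y ∂μ) ^ q ∂μ
          ≤ ENNReal.ofReal (C * a ^ q * r ^ lam) := by
  have hc := h.c_pos
  have hA := h.A_pos
  have hp0 : 0 < p := by linarith
  have hlam : lam < Q := by
    have := (lt_div_iff₀ hp0).1 hγp
    nlinarith [mul_pos hγ hp0]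
  obtain ⟨C₁, hC₁, hpt⟩ := h.exists_lintegral_kernel_rpow_le hγ hγQ hp hγp hq0 hq
  obtain ⟨C₂, hC₂, hmax⟩ := h.lintegral_dyadicMaximal_rpow_le hp
  set K := c ^ (1 - 1 / p) with hK
  have hK0 : 0 < K := by positivity
  refine ⟨C₁ * (2 ^ (p - 1) * (C₂ * (2 * A) ^ lam + K ^ p * c)), by positivity,
    fun f a hf ha hM x₀ r hr => ?_⟩
  set B := {x | d x₀ x < r} with hB
  have hBm : MeasurableSet B := h.measurableSet_ball x₀ r
  set g := {y | d x₀ y < 2 * A * r}.indicator f with hg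
  have hgm : Measurable g := hf.indicator (h.measurableSet_ball _ _)
  set b := K * a * r ^ (-((Q - lam) / p)) with hb
  have hb0 : 0 < b := by positivity
  -- The far part is bounded by the constant `b`; the volume bound `c * r ^ Q` turns `r ^ (lam - Q)`
  -- into the required `r ^ lam`.
  have hbp : b ^ p * (c * r ^ Q) = K ^ p * c * a ^ p * r ^ lam := by
    rw [hb, Real.mul_rpow (by positivity) (by positivity), Real.mul_rpow hK0.le ha.le,
      ← Real.rpow_mul hr.le]
    have h1 : -((Q - lam) / p) * p = lam - Q := by field_simp; ring
    have h2 : r ^ lam = r ^ (lam - Q) * r ^ Q := by rw [← Real.rpow_add hr, sub_add_cancel]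
    rw [h1, h2]; ring
  have hgint : ∫⁻ x, g x ^ p ∂μ ≤ ENNReal.ofReal (a ^ p * (2 * A * r) ^ lam) := by
    refine le_trans (le_of_eq ?_) (hM x₀ (2 * A * r) (by positivity))
    rw [← lintegral_indicator (h.measurableSet_ball _ _)]
    refine lintegral_congr fun x => ?_
    by_cases hx : d x₀ x < 2 * A * r
    · rw [hg, Set.indicator_of_mem (by exact hx), Set.indicator_of_mem (by exact hx)]
    · rw [hg, Set.indicator_of_notMem (by exact hx), Set.indicator_of_notMem (by exact hx),
        ENNReal.zero_rpow_of_pos hp0]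
  calc _ ≤ ∫⁻ x in B, ENNReal.ofReal (C₁ * a ^ (q - p)) *
        (2 ^ (p - 1) * (dyadicMaximal μ d Q g x ^ p + ENNReal.ofReal b ^ p)) ∂μ := by
        refine setLIntegral_mono' hBm fun x hx => (hpt f a hf ha hM x).trans ?_
        gcongr
        refine (ENNReal.rpow_le_rpow (h.dyadicMaximal_le_local_add hp hlam ha hf hM hr hx)
          hp0.le).trans ?_
        exact ENNReal.rpow_add_le_mul_rpow_add_rpow _ _ hp.le
    _ = ENNReal.ofReal (C₁ * a ^ (q - p)) * (2 ^ (p - 1) *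
        (∫⁻ x in B, dyadicMaximal μ d Q g x ^ p ∂μ + ENNReal.ofReal b ^ p * μ B)) := by
        have hMm := (h.measurable_dyadicMaximal hgm).pow_const p
        rw [lintegral_const_mul _ ((hMm.add_const _).const_mul _),
          lintegral_const_mul _ (hMm.add_const _), lintegral_add_left hMm, setLIntegral_const]
    _ ≤ ENNReal.ofReal (C₁ * a ^ (q - p)) * (2 ^ (p - 1) *
        (ENNReal.ofReal C₂ * ENNReal.ofReal (a ^ p * (2 * A * r) ^ lam)
          + ENNReal.ofReal b ^ p * ENNReal.ofReal (c * r ^ Q))) := by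
        gcongr
        · exact (setLIntegral_le_lintegral _ _).trans ((hmax g hgm).trans (by gcongr))
        · exact h.measure_ball_le x₀ r hr
    _ = _ := by
        have h2 : (2 : ℝ≥0∞) ^ (p - 1) = ENNReal.ofReal (2 ^ (p - 1)) := by
          rw [← ENNReal.ofReal_rpow_of_pos two_pos, ENNReal.ofReal_ofNat]
        rw [h2, ENNReal.ofReal_rpow_of_pos hb0, ← ENNReal.ofReal_mul (by positivity),
          ← ENNReal.ofReal_mul (by positivity), ← ENNReal.ofReal_add (by positivity)
          (by positivity), ← ENNReal.ofReal_mul (by positivity),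
          ← ENNReal.ofReal_mul (by positivity), hbp, Real.mul_rpow (by positivity) hr.le]
        congr 1
        have : a ^ q = a ^ (q - p) * a ^ p := by rw [← Real.rpow_add ha, sub_add_cancel]
        rw [this]
        ring

lemma measurable_lintegral_kernel [SecondCountableTopology X] [SFinite μ]
    (h : IsUpperRegularQuasiMetric μ d A c Q) (s : ℝ) {f : X → ℝ≥0∞} (hf : Measurable f) :
    Measurable fun x => ∫⁻ y, ENNReal.ofReal (d x y ^ s) * f y ∂μ := by
  have hd : Measurable fun z : X × X => d z.1 z.2 := h.continuous.measurable
  exact Measurable.lintegral_prod_right'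
    (f := fun z : X × X => ENNReal.ofReal (d z.1 z.2 ^ s) * f z.2)
    ((hd.pow_const s).ennreal_ofReal.mul (hf.comp measurable_snd))

end IsUpperRegularQuasiMetric

/-! ### Dilations and their Jacobians. -/

section Dilation

variable {N : ℕ} {ν : Fin N → ℝ}

lemma dilation_one (x : EuclideanSpace ℝ (Fin N)) : dilation ν 1 x = x := by
  ext i; simp [dilation]

lemma dilation_inv_dilation {t : ℝ} (ht : 0 < t) (x : EuclideanSpace ℝ (Fin N)) :
    dilation ν t⁻¹ (dilation ν t x) = x := by
  ext i
  simp only [dilation]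
  rw [← mul_assoc, ← Real.mul_rpow (by positivity) ht.le, inv_mul_cancel₀ ht.ne', Real.one_rpow,
    one_mul]

lemma dilation_dilation_inv {t : ℝ} (ht : 0 < t) (x : EuclideanSpace ℝ (Fin N)) :
    dilation ν t (dilation ν t⁻¹ x) = x := by
  simpa using dilation_inv_dilation (ν := ν) (inv_pos.2 ht) x

lemma continuous_dilation (hν : ∀ i, 0 < ν i) (x : EuclideanSpace ℝ (Fin N)) :
    Continuous fun t => dilation ν t x := by
  unfold dilation
  refine (PiLp.continuous_toLp 2 _).comp (continuous_pi fun i => ?_)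
  exact (Real.continuous_rpow_const (hν i).le).mul continuous_const

lemma dilation_zero_left (hν : ∀ i, 0 < ν i) (x : EuclideanSpace ℝ (Fin N)) :
    dilation ν 0 x = 0 := by
  ext i; simp [dilation, Real.zero_rpow (hν i).ne']

lemma tendsto_dilation (hν : ∀ i, 0 < ν i) (x : EuclideanSpace ℝ (Fin N)) :
    Filter.Tendsto (fun t => dilation ν t x) (nhdsWithin 0 (Set.Ioi 0)) (nhds 0) := by
  have := (continuous_dilation hν x).tendsto 0
  rw [dilation_zero_left hν] at this
  exact this.mono_left nhdsWithin_le_nhds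

/-- The dilation `D_t` as a linear map. -/
noncomputable def dilationLinear (ν : Fin N → ℝ) (t : ℝ) :
    EuclideanSpace ℝ (Fin N) →L[ℝ] EuclideanSpace ℝ (Fin N) :=
  LinearMap.toContinuousLinearMap
    { toFun := dilation ν t
      map_add' := fun x y => by ext i; simp [dilation, mul_add]
      map_smul' := fun a x => by ext i; simp [dilation, mul_left_comm] }

lemma dilationLinear_apply (t : ℝ) (x : EuclideanSpace ℝ (Fin N)) :
    dilationLinear ν t x = dilation ν t x := rfl

lemma det_dilationLinear {t : ℝ} (ht : 0 < t) :
    (dilationLinear ν t).det = t ^ homogeneousDim ν := by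
  have hb : LinearMap.toMatrix (EuclideanSpace.basisFun (Fin N) ℝ).toBasis
      (EuclideanSpace.basisFun (Fin N) ℝ).toBasis
      (dilationLinear ν t : EuclideanSpace ℝ (Fin N) →ₗ[ℝ] EuclideanSpace ℝ (Fin N))
      = Matrix.diagonal fun i => t ^ ν i := by
    ext i j
    rw [LinearMap.toMatrix_apply]
    by_cases hij : i = j
    · subst hij; simp [dilationLinear_apply, dilation]
    · simp [dilationLinear_apply, dilation, hij]
  rw [ContinuousLinearMap.det,
    ← LinearMap.det_toMatrix (EuclideanSpace.basisFun (Fin N) ℝ).toBasis, hb, Matrix.det_diagonal,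
    homogeneousDim, Real.rpow_sum_of_pos ht]

end Dilation

lemma continuousLinearMap_det_comp {E : Type*} [NormedAddCommGroup E] [NormedSpace ℝ E]
    (f g : E →L[ℝ] E) : (f.comp g).det = f.det * g.det :=
  LinearMap.det_comp _ _

/-! ### Left invariance of Lebesgue measure. -/

namespace IsHomogeneousGroup

variable {N : ℕ} [Group (EuclideanSpace ℝ (Fin N))] {ν : Fin N → ℝ}

lemma contDiff_mul (hG : IsHomogeneousGroup ν) :
    ContDiff ℝ ∞ fun z : EuclideanSpace ℝ (Fin N) × EuclideanSpace ℝ (Fin N) => z.1 * z.2 := by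
  have := hG.lieGroup
  have h := contMDiff_mul (𝓡 N) ∞ (G := EuclideanSpace ℝ (Fin N))
  rw [← modelWithCornersSelf_prod, chartedSpaceSelf_prod] at h
  exact contMDiff_iff_contDiff.1 h

lemma isTopologicalGroup (hG : IsHomogeneousGroup ν) :
    IsTopologicalGroup (EuclideanSpace ℝ (Fin N)) :=
  have := hG.lieGroup
  topologicalGroup_of_lieGroup (𝓡 N) ∞

lemma dilation_one_eq_one (hG : IsHomogeneousGroup ν) {t : ℝ} (ht : 0 < t) :
    dilation ν t (1 : EuclideanSpace ℝ (Fin N)) = 1 := by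
  have h := hG.dilation_mul t ht 1 1
  rw [one_mul] at h
  exact left_eq_mul.1 h

/-- Dilations fix the identity, yet contract every point to the origin as `t → 0`. -/
lemma one_eq_zero (hG : IsHomogeneousGroup ν) : (1 : EuclideanSpace ℝ (Fin N)) = 0 := by
  refine tendsto_nhds_unique ?_ (tendsto_dilation hG.weight_pos 1)
  refine tendsto_const_nhds.congr' ?_
  filter_upwards [self_mem_nhdsWithin] with t ht
  exact (hG.dilation_one_eq_one ht).symm

lemma hasFDerivAt_mul_left (hG : IsHomogeneousGroup ν) (x y : EuclideanSpace ℝ (Fin N)) :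
    HasFDerivAt (fun w => x * w) (fderiv ℝ (fun w => x * w) y) y := by
  have : ContDiff ℝ ∞ fun w : EuclideanSpace ℝ (Fin N) => x * w :=
    hG.contDiff_mul.comp (contDiff_const.prodMk contDiff_id)
  exact (this.differentiable (by simp) y).hasFDerivAt

/-- Differentiate `D_t (x * w) = D_t x * D_t w` at `w = 0`: the factor `det D_t` cancels, so
translation by `D_t x` has the same Jacobian at `0` as translation by `x`. As `t → 0` the
translation tends to the identity map, and continuity of the Jacobian gives `1`. -/
lemma det_fderiv_mul_left_zero (hG : IsHomogeneousGroup ν) (x : EuclideanSpace ℝ (Fin N)) :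
    (fderiv ℝ (fun w => x * w) 0).det = 1 := by
  have hcont : Continuous fun z : EuclideanSpace ℝ (Fin N) =>
      (fderiv ℝ (fun w => z * w) 0).det := by
    refine ContinuousLinearMap.continuous_det.comp ?_
    exact (ContDiff.fderiv (f := fun z w : EuclideanSpace ℝ (Fin N) => z * w) (n := 0)
      hG.contDiff_mul contDiff_const (by simp)).continuous
  have hinv : ∀ t : ℝ, 0 < t → (fderiv ℝ (fun w => dilation ν t x * w) 0).det
      = (fderiv ℝ (fun w => x * w) 0).det := by
    intro t ht
    have h1 : HasFDerivAt (fun w => dilation ν t (x * w))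
        ((dilationLinear ν t).comp (fderiv ℝ (fun w => x * w) 0)) 0 :=
      (dilationLinear ν t).hasFDerivAt.comp _ (hG.hasFDerivAt_mul_left x 0)
    have h0 : HasFDerivAt (fun w => dilation ν t x * w)
        (fderiv ℝ (fun w => dilation ν t x * w) 0) (dilationLinear ν t 0) := by
      rw [map_zero]; exact hG.hasFDerivAt_mul_left _ 0
    have h2 := h0.comp 0 (dilationLinear ν t).hasFDerivAt
    have h3 : (fun w => dilation ν t (x * w))
        = (fun w => dilation ν t x * w) ∘ (dilationLinear ν t) := by
      ext1 w; exact hG.dilation_mul t ht x w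
    rw [h3] at h1
    have h4 := congrArg ContinuousLinearMap.det (h1.unique h2)
    rw [continuousLinearMap_det_comp, continuousLinearMap_det_comp, mul_comm,
      det_dilationLinear ht] at h4
    exact (mul_right_cancel₀ (by positivity) h4).symm
  have h1 := (hcont.tendsto 0).comp (tendsto_dilation hG.weight_pos x)
  have h2 : (fderiv ℝ (fun w : EuclideanSpace ℝ (Fin N) => 0 * w) 0).det = 1 := by
    have : (fun w : EuclideanSpace ℝ (Fin N) => 0 * w) = id := by
      ext1 w; rw [← hG.one_eq_zero, one_mul]; rfl
    rw [this, fderiv_id, ContinuousLinearMap.det, ContinuousLinearMap.coe_id, LinearMap.det_id]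
  rw [h2] at h1
  refine tendsto_nhds_unique (tendsto_const_nhds.congr' ?_) h1
  filter_upwards [self_mem_nhdsWithin] with t ht
  exact (hinv t ht).symm

/-- The chain rule at `0` for translation by `y` followed by translation by `x` reduces this to the
Jacobians at the origin. -/
lemma det_fderiv_mul_left (hG : IsHomogeneousGroup ν) (x y : EuclideanSpace ℝ (Fin N)) :
    (fderiv ℝ (fun w => x * w) y).det = 1 := by
  have h0 : HasFDerivAt (fun w => x * w) (fderiv ℝ (fun w => x * w) y) (y * 0) := by
    rw [← hG.one_eq_zero, mul_one]; exact hG.hasFDerivAt_mul_left x y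
  have h1 := h0.comp 0 (hG.hasFDerivAt_mul_left y 0)
  have h2 : (fun w => x * w) ∘ (fun w => y * w) = fun w => (x * y) * w := by
    ext1 w; simp [mul_assoc]
  rw [h2] at h1
  have h3 := congrArg ContinuousLinearMap.det (h1.unique (hG.hasFDerivAt_mul_left (x * y) 0))
  rwa [hG.det_fderiv_mul_left_zero, continuousLinearMap_det_comp, hG.det_fderiv_mul_left_zero,
    mul_one] at h3

/-- Lebesgue measure is invariant under the left translations of a homogeneous group. -/
lemma volume_image_mul_left (hG : IsHomogeneousGroup ν) (x : EuclideanSpace ℝ (Fin N))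
    {s : Set (EuclideanSpace ℝ (Fin N))} (hs : MeasurableSet s) :
    volume ((fun w => x * w) '' s) = volume s := by
  rw [← lintegral_abs_det_fderiv_eq_addHaar_image volume hs
    (fun y _ => (hG.hasFDerivAt_mul_left x y).hasFDerivWithinAt) (mul_right_injective x).injOn]
  simp [hG.det_fderiv_mul_left]

end IsHomogeneousGroup

/-! ### Geometry of quasi-norms. -/

namespace IsHomogeneousQuasiNorm

variable {N : ℕ} [Group (EuclideanSpace ℝ (Fin N))] {ν : Fin N → ℝ}
  {nrm : EuclideanSpace ℝ (Fin N) → ℝ}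

/-- The quasi-norm has a positive minimum on the Euclidean unit sphere. By the intermediate value
theorem a point outside the unit ball is dilated onto the sphere by some `t ≤ 1`, which does not
increase its quasi-norm. -/
lemma exists_le_of_one_le_norm (hn : IsHomogeneousQuasiNorm ν nrm) (hν : ∀ i, 0 < ν i) :
    ∃ m : ℝ, 0 < m ∧ ∀ x, 1 ≤ ‖x‖ → m ≤ nrm x := by
  have hS : IsCompact (Metric.sphere (0 : EuclideanSpace ℝ (Fin N)) 1) := isCompact_sphere 0 1
  obtain ⟨m, hm, hmS⟩ : ∃ m : ℝ, 0 < m ∧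
      ∀ x ∈ Metric.sphere (0 : EuclideanSpace ℝ (Fin N)) 1, m ≤ nrm x := by
    rcases (Metric.sphere (0 : EuclideanSpace ℝ (Fin N)) 1).eq_empty_or_nonempty with he | hne
    · exact ⟨1, one_pos, by simp [he]⟩
    · obtain ⟨x₀, hx₀, hmin⟩ := hS.exists_isMinOn hne hn.continuous.continuousOn
      refine ⟨nrm x₀, lt_of_le_of_ne (hn.nonneg _) fun h => ?_, fun x hx => hmin hx⟩
      rw [(hn.eq_zero_iff x₀).1 h.symm] at hx₀
      simp at hx₀
  refine ⟨m, hm, fun x hx => ?_⟩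
  have hc : ContinuousOn (fun t => ‖_root_.dilation ν t x‖) (Set.Icc 0 1) :=
    (continuous_dilation hν x).norm.continuousOn
  obtain ⟨t, ht, hxt⟩ := intermediate_value_Icc zero_le_one hc
    (show (1 : ℝ) ∈ _ by simp [dilation_zero_left hν, dilation_one, hx])
  have ht0 : 0 < t := by
    refine lt_of_le_of_ne ht.1 fun h => ?_
    simp [← h, dilation_zero_left hν] at hxt
  have h1 := hmS (_root_.dilation ν t x) (by simpa using hxt)
  rw [hn.dilation t ht0] at h1
  exact h1.trans (mul_le_of_le_one_left (hn.nonneg x) ht.2)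

lemma isBounded_le_one (hn : IsHomogeneousQuasiNorm ν nrm) (hν : ∀ i, 0 < ν i) :
    Bornology.IsBounded {x | nrm x ≤ 1} := by
  obtain ⟨m, hm, hle⟩ := hn.exists_le_of_one_le_norm hν
  have hs : 0 < m / 2 := by positivity
  have hsub : {x | nrm x ≤ 1} ⊆ dilationLinear ν (m / 2)⁻¹ '' Metric.closedBall 0 1 := by
    intro x hx
    refine ⟨_root_.dilation ν (m / 2) x, ?_, ?_⟩
    · rw [mem_closedBall_zero_iff]
      by_contra! h
      have := hle _ h.le
      rw [hn.dilation _ hs] at this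
      have hx : nrm x ≤ 1 := hx
      nlinarith
    · exact dilation_inv_dilation hs x
  have hK := (isCompact_closedBall 0 1).image (dilationLinear ν (m / 2)⁻¹).continuous
  exact hK.isBounded.subset hsub

lemma isCompact_le_one (hn : IsHomogeneousQuasiNorm ν nrm) (hν : ∀ i, 0 < ν i) :
    IsCompact {x | nrm x ≤ 1} :=
  Metric.isCompact_of_isClosed_isBounded (isClosed_le hn.continuous continuous_const)
    (hn.isBounded_le_one hν)

lemma map_zero (hn : IsHomogeneousQuasiNorm ν nrm) : nrm 0 = 0 := (hn.eq_zero_iff 0).2 rfl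

/-- By homogeneity one may scale `|x| + |y|` to `1`; then `|x * y|` is a continuous function on a
compact product of unit quasi-balls, hence bounded. -/
lemma exists_quasi_triangle (hn : IsHomogeneousQuasiNorm ν nrm) (hG : IsHomogeneousGroup ν) :
    ∃ A : ℝ, 0 < A ∧ ∀ x y, nrm (x * y) ≤ A * (nrm x + nrm y) := by
  have hK := (hn.isCompact_le_one hG.weight_pos).prod (hn.isCompact_le_one hG.weight_pos)
  obtain ⟨A, hA⟩ := hK.bddAbove_image (f := fun z : _ × _ => nrm (z.1 * z.2))
    (Continuous.continuousOn (hn.continuous.comp hG.contDiff_mul.continuous))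
  refine ⟨max A 1, by positivity, fun x y => ?_⟩
  have hx := hn.nonneg x
  have hy := hn.nonneg y
  rcases (add_nonneg hx hy).eq_or_lt with h | h
  · rw [(hn.eq_zero_iff x).1 (by linarith), (hn.eq_zero_iff y).1 (by linarith)]
    rw [← hG.one_eq_zero, one_mul, hG.one_eq_zero, hn.map_zero]
    simp
  · set t := nrm x + nrm y
    have ht : 0 < t⁻¹ := inv_pos.2 h
    have hle : ∀ z, nrm z ≤ t → nrm (_root_.dilation ν t⁻¹ z) ≤ 1 := by
      intro z hz
      rw [hn.dilation _ ht, inv_mul_le_iff₀ h, mul_one]; exact hz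
    have := hA (Set.mem_image_of_mem _
      (show (_root_.dilation ν t⁻¹ x, _root_.dilation ν t⁻¹ y) ∈ _ from
      ⟨hle x (by linarith), hle y (by linarith)⟩))
    simp only [← hG.dilation_mul _ ht, hn.dilation _ ht] at this
    rw [inv_mul_le_iff₀ h, mul_comm] at this
    exact this.trans (by gcongr; exact le_max_left _ _)

lemma volume_quasiBall (hn : IsHomogeneousQuasiNorm ν nrm) (hG : IsHomogeneousGroup ν)
    (x : EuclideanSpace ℝ (Fin N)) {r : ℝ} (hr : 0 < r) :
    volume (quasiBall nrm x r) = ENNReal.ofReal (r ^ homogeneousDim ν) * volume {y | nrm y < 1} := by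
  have hB : MeasurableSet {y | nrm y < r} :=
    (isOpen_lt hn.continuous continuous_const).measurableSet
  have h1 : quasiBall nrm x r = (fun w => x * w) '' {y | nrm y < r} := by
    ext y
    simp only [quasiBall, Set.mem_ofPred_eq, Set.mem_image]
    refine ⟨fun h => ⟨x⁻¹ * y, h, by simp⟩, ?_⟩
    rintro ⟨w, hw, rfl⟩
    simpa using hw
  have h2 : {y | nrm y < r} = dilationLinear ν r '' {y | nrm y < 1} := by
    ext y
    simp only [Set.mem_ofPred_eq, Set.mem_image, dilationLinear_apply]
    refine ⟨fun h => ⟨_root_.dilation ν r⁻¹ y, ?_, dilation_dilation_inv hr y⟩, ?_⟩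
    · rw [hn.dilation _ (inv_pos.2 hr), inv_mul_lt_iff₀ hr, mul_one]; exact h
    · rintro ⟨w, hw, rfl⟩
      rw [hn.dilation _ hr]
      exact mul_lt_of_lt_one_right hr hw
  rw [h1, hG.volume_image_mul_left x hB, h2, Measure.addHaar_image_continuousLinearMap]
  change ENNReal.ofReal |(dilationLinear ν r).det| * _ = _
  rw [det_dilationLinear hr, abs_of_pos (by positivity)]

/-- The left-invariant quasi-metric `|x⁻¹ y|` of a homogeneous group is upper regular of
dimension `Q`. -/
lemma exists_isUpperRegularQuasiMetric (hn : IsHomogeneousQuasiNorm ν nrm)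
    (hG : IsHomogeneousGroup ν) (hQ : 0 < homogeneousDim ν) :
    ∃ A c : ℝ, IsUpperRegularQuasiMetric volume (fun x y => nrm (x⁻¹ * y)) A c
      (homogeneousDim ν) := by
  obtain ⟨A, hA, htri⟩ := hn.exists_quasi_triangle hG
  have := hG.isTopologicalGroup
  have hfin : volume {y | nrm y < 1} ≠ ⊤ :=
    ((measure_mono fun y (hy : nrm y < 1) => hy.le).trans_lt
      (hn.isCompact_le_one hG.weight_pos).measure_lt_top).ne
  -- Adding `1` makes `c` positive without a lower bound on the volume of the unit ball.
  refine ⟨A, (volume {y | nrm y < 1}).toReal + 1, ?_⟩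
  refine ⟨?_, fun x y => hn.nonneg _, fun x => ?_, fun x y => ?_, fun x y z => ?_, hA,
    by positivity, hQ, fun x r hr => ?_⟩
  · exact hn.continuous.comp (continuous_fst.inv.mul continuous_snd)
  · simp [hG.one_eq_zero, hn.map_zero]
  · rw [← hn.inv]; simp
  · have := htri (x⁻¹ * y) (y⁻¹ * z)
    rwa [mul_assoc, mul_inv_cancel_left] at this
  · change volume (quasiBall nrm x r) ≤ _
    rw [hn.volume_quasiBall hG x hr, mul_comm (_ + _), ENNReal.ofReal_mul (by positivity)]
    gcongr
    rw [ENNReal.le_ofReal_iff_toReal_le hfin (by positivity)]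
    linarith

end IsHomogeneousQuasiNorm

/-! ### Morrey norms as bounds on balls. -/

section Morrey

variable {N : ℕ} [Group (EuclideanSpace ℝ (Fin N))]
  {nrm : EuclideanSpace ℝ (Fin N) → ℝ} {p lam a : ℝ} {f : EuclideanSpace ℝ (Fin N) → ℝ}

lemma setLIntegral_quasiBall_le_of_morreyNorm_le (hp : 0 < p) (ha : 0 < a)
    (hf : morreyNorm nrm p lam f ≤ ENNReal.ofReal a) (x : EuclideanSpace ℝ (Fin N)) {r : ℝ}
    (hr : 0 < r) :
    ∫⁻ y in quasiBall nrm x r, ‖f y‖ₑ ^ p ≤ ENNReal.ofReal (a ^ p * r ^ lam) := by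
  rw [morreyNorm, one_div, ENNReal.rpow_inv_le_iff hp, ENNReal.ofReal_rpow_of_pos ha] at hf
  have h1 := (le_iSup₂_of_le (f := fun (x : EuclideanSpace ℝ (Fin N)) (r : ℝ) => ⨆ (_ : 0 < r),
    ENNReal.ofReal (r ^ (-lam)) * ∫⁻ y in quasiBall nrm x r, ‖f y‖ₑ ^ p) x r
    (le_iSup_of_le hr le_rfl)).trans hf
  calc _ = ENNReal.ofReal (r ^ lam) *
        (ENNReal.ofReal (r ^ (-lam)) * ∫⁻ y in quasiBall nrm x r, ‖f y‖ₑ ^ p) := by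
        rw [← mul_assoc, ← ENNReal.ofReal_mul (by positivity), ← Real.rpow_add hr, add_neg_cancel,
          Real.rpow_zero, ENNReal.ofReal_one, one_mul]
    _ ≤ ENNReal.ofReal (r ^ lam) * ENNReal.ofReal (a ^ p) := by gcongr
    _ = _ := by rw [← ENNReal.ofReal_mul (by positivity), mul_comm]

lemma morreyNorm_le_of_setLIntegral_quasiBall_le (hp : 0 < p) (ha : 0 < a)
    (hf : ∀ x r, 0 < r →
      ∫⁻ y in quasiBall nrm x r, ‖f y‖ₑ ^ p ≤ ENNReal.ofReal (a ^ p * r ^ lam)) :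
    morreyNorm nrm p lam f ≤ ENNReal.ofReal a := by
  rw [morreyNorm, one_div, ENNReal.rpow_inv_le_iff hp, ENNReal.ofReal_rpow_of_pos ha]
  refine iSup_le fun x => iSup₂_le fun r hr => ?_
  calc _ ≤ ENNReal.ofReal (r ^ (-lam)) * ENNReal.ofReal (a ^ p * r ^ lam) := by
        gcongr; exact hf x r hr
    _ = _ := by
        rw [← ENNReal.ofReal_mul (by positivity), mul_left_comm, ← Real.rpow_add hr,
          neg_add_cancel, Real.rpow_zero, mul_one]

end Morrey

namespace IsHomogeneousQuasiNorm

variable {N : ℕ} [Group (EuclideanSpace ℝ (Fin N))] {ν : Fin N → ℝ}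
  {nrm : EuclideanSpace ℝ (Fin N) → ℝ}

lemma enorm_rieszIntegrand (hn : IsHomogeneousQuasiNorm ν nrm) (γ : ℝ)
    (u : EuclideanSpace ℝ (Fin N) → ℝ) (x y : EuclideanSpace ℝ (Fin N)) :
    ‖rieszIntegrand ν nrm γ u x y‖ₑ
      = ENNReal.ofReal (nrm (x⁻¹ * y) ^ (γ - homogeneousDim ν)) * ‖u y‖ₑ := by
  rw [rieszIntegrand, enorm_mul, Real.enorm_of_nonneg (Real.rpow_nonneg (hn.nonneg _) _),
    ← hn.inv (y⁻¹ * x), mul_inv_rev, inv_inv]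

/-- A compact set is contained in a quasi-ball around the origin. -/
lemma exists_subset_quasiBall_zero (hn : IsHomogeneousQuasiNorm ν nrm)
    (hG : IsHomogeneousGroup ν) {K : Set (EuclideanSpace ℝ (Fin N))} (hK : IsCompact K) :
    ∃ r, 0 < r ∧ K ⊆ quasiBall nrm 0 r := by
  obtain ⟨R, hR⟩ := hK.bddAbove_image hn.continuous.continuousOn
  refine ⟨max R 0 + 1, by positivity, fun x hx => ?_⟩
  have := hR (Set.mem_image_of_mem nrm hx)
  simp only [quasiBall, Set.mem_ofPred_eq, ← hG.one_eq_zero, inv_one, one_mul]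
  linarith [le_max_left R 0]

end IsHomogeneousQuasiNorm

/-! ### The theorem on homogeneous groups. -/

theorem theorem3p2 {N : ℕ} [Group (EuclideanSpace ℝ (Fin N))]
    (ν : Fin N → ℝ) (hG : IsHomogeneousGroup ν)
    (nrm : EuclideanSpace ℝ (Fin N) → ℝ) (hnrm : IsHomogeneousQuasiNorm ν nrm)
    (γ p q lam : ℝ)
    (hγ : 0 < γ) (hγQ : γ < homogeneousDim ν)
    (hp : 1 < p) (hpQ : p < homogeneousDim ν / γ)
    (hlam : 0 < lam) (hlamQ : lam < homogeneousDim ν - γ * p)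
    (hq : 1 / q = 1 / p - γ / (homogeneousDim ν - lam)) :
    ∃ C : ℝ, 0 < C ∧ ∀ u : EuclideanSpace ℝ (Fin N) → ℝ, MemMorrey nrm p lam u →
      (∀ᵐ x, Integrable (rieszIntegrand ν nrm γ u x)) ∧
      MemMorrey nrm q lam (rieszPotential ν nrm γ u) ∧
      morreyNorm nrm q lam (rieszPotential ν nrm γ u)
        ≤ ENNReal.ofReal C * morreyNorm nrm p lam u := by
  have hp0 : 0 < p := by linarith
  have hQl : 0 < homogeneousDim ν - lam := by nlinarith [mul_pos hγ hp0]
  have hγp : γ < (homogeneousDim ν - lam) / p := by rw [lt_div_iff₀ hp0]; linarith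
  have hq0 : 0 < q := by
    rw [← one_div_pos, hq, sub_pos, div_lt_div_iff₀ hQl hp0]; linarith
  obtain ⟨A, c, hd⟩ := hnrm.exists_isUpperRegularQuasiMetric hG (hγ.trans hγQ)
  obtain ⟨C, hC, hmain⟩ := hd.exists_setLIntegral_kernel_rpow_le hγ hγQ hp hγp hq0 hq
  refine ⟨C ^ (1 / q), by positivity, fun u hu => ?_⟩
  set J : EuclideanSpace ℝ (Fin N) → ℝ≥0∞ := fun x =>
    ∫⁻ y, ENNReal.ofReal (nrm (x⁻¹ * y) ^ (γ - homogeneousDim ν)) * ‖u y‖ₑ with hJ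
  -- The general bound needs a measurable function; replacing `u` by `w` changes no integral in `y`.
  obtain ⟨w, hw, huw⟩ := hu.aestronglyMeasurable
  have hfm : Measurable fun y => ‖w y‖ₑ := hw.measurable.enorm
  have hJw : J = fun x =>
      ∫⁻ y, ENNReal.ofReal (nrm (x⁻¹ * y) ^ (γ - homogeneousDim ν)) * ‖w y‖ₑ := by
    ext x
    refine lintegral_congr_ae ?_
    filter_upwards [huw] with y hy
    rw [hy]
  have hJm : Measurable J := by rw [hJw]; exact hd.measurable_lintegral_kernel _ hfm
  have hball : ∀ a : ℝ, 0 < a → morreyNorm nrm p lam u ≤ ENNReal.ofReal a → ∀ x r, 0 < r →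
      ∫⁻ y in quasiBall nrm x r, J y ^ q ≤ ENNReal.ofReal ((C ^ (1 / q) * a) ^ q * r ^ lam) := by
    intro a ha hua x r hr
    rw [hJw, Real.mul_rpow (by positivity) ha.le, ← Real.rpow_mul hC.le,
      one_div_mul_cancel hq0.ne', Real.rpow_one]
    refine hmain _ a hfm ha (fun x r hr => ?_) x r hr
    refine le_trans (le_of_eq ?_) (setLIntegral_quasiBall_le_of_morreyNorm_le hp0 ha hua x hr)
    refine lintegral_congr_ae (ae_restrict_of_ae ?_)
    filter_upwards [huw] with y hy
    rw [hy]
  have hIJ : ∀ x, ‖rieszPotential ν nrm γ u x‖ₑ ≤ J x := fun x => by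
    refine (enorm_integral_le_lintegral_enorm _).trans_eq ?_
    simp only [hnrm.enorm_rieszIntegrand, hJ]
  have hIball : ∀ a : ℝ, 0 < a → morreyNorm nrm p lam u ≤ ENNReal.ofReal a → ∀ x r, 0 < r →
      ∫⁻ y in quasiBall nrm x r, ‖rieszPotential ν nrm γ u y‖ₑ ^ q
        ≤ ENNReal.ofReal ((C ^ (1 / q) * a) ^ q * r ^ lam) := fun a ha hua x r hr =>
    (lintegral_mono fun y => ENNReal.rpow_le_rpow (hIJ y) hq0.le).trans (hball a ha hua x r hr)
  have hnorm : morreyNorm nrm q lam (rieszPotential ν nrm γ u)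
      ≤ ENNReal.ofReal (C ^ (1 / q)) * morreyNorm nrm p lam u := by
    have htop := hu.morreyNorm_lt_top.ne
    set M := (morreyNorm nrm p lam u).toReal with hM
    have hMof : morreyNorm nrm p lam u = ENNReal.ofReal M := (ENNReal.ofReal_toReal htop).symm
    have hcont : Continuous fun a : ℝ => ENNReal.ofReal (C ^ (1 / q)) * ENNReal.ofReal a :=
      (ENNReal.continuous_const_mul ENNReal.ofReal_ne_top).comp ENNReal.continuous_ofReal
    rw [hMof]
    -- The ball estimates require `a > 0`, so the norm `M`, possibly zero, is approached from above.
    refine ge_of_tendsto ((hcont.tendsto M).mono_left (nhdsWithin_le_nhds (s := Set.Ioi M))) ?_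
    filter_upwards [self_mem_nhdsWithin] with a ha
    have ha0 : 0 < a := ENNReal.toReal_nonneg.trans_lt ha
    rw [← ENNReal.ofReal_mul (by positivity)]
    exact morreyNorm_le_of_setLIntegral_quasiBall_le hq0 (by positivity)
      (hIball a ha0 (hMof.trans_le (ENNReal.ofReal_le_ofReal (le_of_lt ha))))
  have hIm : AEStronglyMeasurable (rieszPotential ν nrm γ u) volume := by
    have : rieszPotential ν nrm γ u = fun x => ∫ y, rieszIntegrand ν nrm γ w x y := by
      ext x
      refine integral_congr_ae ?_
      filter_upwards [huw] with y hy
      simp only [rieszIntegrand, hy]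
    rw [this]
    refine (StronglyMeasurable.integral_prod_right ?_).aestronglyMeasurable
    have := hG.isTopologicalGroup
    have hk : Measurable fun z : EuclideanSpace ℝ (Fin N) × EuclideanSpace ℝ (Fin N) =>
        nrm (z.2⁻¹ * z.1) :=
      (hnrm.continuous.comp (continuous_snd.inv.mul continuous_fst)).measurable
    exact ((hk.pow_const _).mul (hw.measurable.comp measurable_snd)).stronglyMeasurable
  set b := (morreyNorm nrm p lam u).toReal + 1 with hb
  have hb0 : 0 < b := add_pos_of_nonneg_of_pos ENNReal.toReal_nonneg one_pos
  have hub : morreyNorm nrm p lam u ≤ ENNReal.ofReal b := by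
    rw [ENNReal.le_ofReal_iff_toReal_le hu.morreyNorm_lt_top.ne hb0.le]
    linarith
  refine ⟨?_, ⟨hIm, fun K hK => ?_, hnorm.trans_lt
    (ENNReal.mul_lt_top ENNReal.ofReal_lt_top hu.morreyNorm_lt_top)⟩, hnorm⟩
  · have hlt : ∀ n : ℕ, ∀ᵐ x, x ∈ quasiBall nrm 0 (n + 1) → J x < ⊤ := fun n => by
      refine (ae_restrict_iff' (hd.measurableSet_ball 0 _)).1 ?_
      have := ae_lt_top (hJm.pow_const q) ((hball b hb0 hub 0 (n + 1) (by positivity)).trans_lt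
        ENNReal.ofReal_lt_top).ne
      filter_upwards [this] with x hx
      exact (ENNReal.rpow_lt_top_iff_of_pos hq0).1 hx
    filter_upwards [ae_all_iff.2 hlt] with x hx
    obtain ⟨n, hn⟩ := exists_nat_gt (nrm ((0 : EuclideanSpace ℝ (Fin N))⁻¹ * x))
    refine ⟨?_, ?_⟩
    · have := hG.isTopologicalGroup
      have hk : Measurable fun y : EuclideanSpace ℝ (Fin N) => nrm (y⁻¹ * x) :=
        (hnrm.continuous.comp (continuous_inv.mul continuous_const)).measurable
      exact (hk.pow_const _).aestronglyMeasurable.mul hu.aestronglyMeasurable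
    · rw [HasFiniteIntegral]
      simp only [hnrm.enorm_rieszIntegrand]
      exact hx n (hn.trans (lt_add_one _))
  · refine ⟨hIm.restrict, ?_⟩
    obtain ⟨r, hr, hKr⟩ := hnrm.exists_subset_quasiBall_zero hG hK
    rw [eLpNorm_lt_top_iff_lintegral_rpow_enorm_lt_top (by simpa using hq0) ENNReal.ofReal_ne_top,
      ENNReal.toReal_ofReal hq0.le]
    exact ((lintegral_mono_set hKr).trans (hIball b hb0 hub 0 r hr)).trans_lt
      ENNReal.ofReal_lt_top
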